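/- Let $d\ge 1$ be an odd integer, let $p\ge 1$ be real, and let $P\subset\mathbb R^d$ be a convex $d$-polytope, i.e. a bounded intersection of finitely many closed half-spaces whose affine hull is $\mathbb R^d$ (its vertices may be arbitrary real points). Put $c=(2\,\Gamma(1/p+1))^p$, $\phi_\epsilon(x)=\epsilon^{-d/p}e^{-(c/\epsilon)\sum_k|x_k|^p}$ for $x\in\mathbb R^d$, and for $\xi\in\mathbb C^d$ let $$\hat\phi_\epsilon(\xi)=\int_{\mathbb R^d}e^{2\pi i\langle x,\xi\rangle}\phi_\epsilon(x)\,dx,\qquad \hat 1_S(\xi)=\int_S e^{2\pi i\langle x,\xi\rangle}\,dx,$$ where $\langle x,\xi\rangle=\sum_k x_k\xi_k$. The $l^p$-solid angle of $x$ with respect to $S\subseteq\mathbb R^d$ is $\omega_S(x)=\lim_{\epsilon\to0^+}\int_S\phi_\epsilon(y-x)\,dy$, and the solid-angle sum is $$A_P(t,s)=\sum_{m\in\mathbb Z^d}\omega_{tP}(m)\,e^{2\pi i\langle m,s\rangle}.$$ Then $A_P(0,0)=0$, both for this sum and for its extension from $t>0$ to all real $t$. Precisely: 1. For $t=0$ and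 $s=0$ all the solid angles $\omega_{0P}(m)$ exist, and the sum above converges to $0$. 2. For every $m\in\mathbb Z^d$ the function $t\mapsto\hat 1_{tP}(m)$, $t>0$, has a real-analytic continuation $E_m$ to all $t\in\mathbb R$; the series $\sum_{m\in\mathbb Z^d}E_m(0)\,\hat\phi_\epsilon(m)$ is summable for all sufficiently small $\epsilon>0$; and $$\lim_{\epsilon\to0^+}\sum_{m\in\mathbb Z^d}E_m(0)\,\hat\phi_\epsilon(m)=0 .$$ 3. Suppose moreover that $P$ is simple. For each vertex $v$ let $w_1(v),\dots,w_d(v)$ be linearly independent generators of the tangent cone $K(v)=\{\lambda(x-v):x\in P,\ \lambda\ge0\}$, and let $|\det K(v)|$ be the absolute value of the determinant of the matrix with columns $w_j(v)$. Call $s\in\mathbb C^d$ admissible if $\langle w_j(v),m+s\rangle\ne0$ for all $v$, $j$ and all $m\in\mathbb Z^d$. Then $0$ lies in the closure of the set of admissible $s$; for every admissible $s$ the value at $t=0$ of $$A_P(t,s)=\lim_{\epsilon\to0^+}\ \sum_{m\in\mathbb Z^d}\ \sum_{v\text{ a vertex of }P}\frac{|\det K(v)|}{(-2\pi i)^d}\,\frac{e^{2\pi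 i t\langle v,m+s\rangle}\,\hat\phi_\epsilon(m+s)}{\prod_{j=1}^d\langle w_j(v),m+s\rangle}$$ exists (the series over $m$ being summable for all sufficiently small $\epsilon>0$); and $\lim_{s\to0}A_P(0,s)=0$, the limit being taken through admissible $s$. -/

import Mathlib

open Filter Topology MeasureTheory
open scoped Pointwise

namespace SolidAngle

noncomputable section

/-- A convex polytope in `ℝ^d`: a bounded intersection of finitely many closed half-spaces
(a hyperplane is the intersection of two of them). -/
def IsConvexPolytope {d : ℕ} (P : Set (Fin d → ℝ)) : Prop :=
  Bornology.IsBounded P ∧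
    ∃ (n : ℕ) (a : Fin n → Fin d → ℝ) (b : Fin n → ℝ),
      P = {x | ∀ i, ∑ k, a i k * x k ≤ b i}

/-- A convex `d`-polytope in `ℝ^d`: a convex polytope whose affine hull is the whole space. -/
def IsFullPolytope {d : ℕ} (P : Set (Fin d → ℝ)) : Prop :=
  IsConvexPolytope P ∧ affineSpan ℝ P = ⊤

/-- The bilinear pairing `⟨x, ξ⟩ = ∑ x_k ξ_k` of a real vector with a complex vector. -/
def pairing {d : ℕ} (x : Fin d → ℝ) (ξ : Fin d → ℂ) : ℂ :=
  ∑ k, (x k : ℂ) * ξ k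

/-- The lattice point `m ∈ ℤ^d` as a point of `ℝ^d`. -/
def latticePoint {d : ℕ} (m : Fin d → ℤ) : Fin d → ℝ := fun k => (m k : ℝ)

/-- The point `m + s` of `ℂ^d`, for `m ∈ ℤ^d` and `s ∈ ℂ^d`. -/
def shifted {d : ℕ} (m : Fin d → ℤ) (s : Fin d → ℂ) : Fin d → ℂ := fun k => (m k : ℂ) + s k

/-- `φ_ε(x) = ε^{-d/p} exp(-(c/ε) ‖x‖_p^p)` with `c = (2 Γ(1/p + 1))^p`. -/
def phi {d : ℕ} (p ε : ℝ) (x : Fin d → ℝ) : ℝ :=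
  1 / ε ^ ((d : ℝ) / p) *
    Real.exp (-((2 * Real.Gamma (1 / p + 1)) ^ p) / ε * ∑ k, |x k| ^ p)

/-- `ω` is the `l^p`-solid angle of the point `x` with respect to the set `S`:
`ω = lim_{ε → 0+} ∫_S φ_ε(y - x) dy`. -/
def IsSolidAngle {d : ℕ} (p : ℝ) (S : Set (Fin d → ℝ)) (x : Fin d → ℝ) (ω : ℝ) : Prop :=
  Tendsto (fun ε : ℝ => ∫ y in S, phi p ε (y - x)) (𝓝[>] 0) (𝓝 ω)

/-- `a` is the solid-angle sum `∑_{m ∈ ℤ^d} ω_{tP}(m) e^{2πi⟨m, s⟩}`: all the solid angles exist,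
and the series converges to `a`. -/
def HasSolidAngleSum {d : ℕ} (p : ℝ) (P : Set (Fin d → ℝ)) (t : ℝ) (s : Fin d → ℂ) (a : ℂ) :
    Prop :=
  ∃ ω : (Fin d → ℤ) → ℝ,
    (∀ m, IsSolidAngle p (t • P) (latticePoint m) (ω m)) ∧
    HasSum (fun m : Fin d → ℤ =>
      (ω m : ℂ) * Complex.exp (2 * Real.pi * Complex.I * pairing (latticePoint m) s)) a

/-- The Fourier-Laplace transform of the indicator function of `S`. -/
def indicatorHat {d : ℕ} (S : Set (Fin d → ℝ)) (ξ : Fin d → ℂ) : ℂ :=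
  ∫ x in S, Complex.exp (2 * Real.pi * Complex.I * pairing x ξ)

/-- The Fourier-Laplace transform of `φ_ε`. -/
def phiHat {d : ℕ} (p ε : ℝ) (ξ : Fin d → ℂ) : ℂ :=
  ∫ x : Fin d → ℝ, Complex.exp (2 * Real.pi * Complex.I * pairing x ξ) * (phi p ε x : ℂ)

/-- `a = lim_{ε → 0+} ∑_{m ∈ ℤ^d} F(m) φ̂_ε(m + s)`, with a convergent series for all small `ε`. -/
def HasDampedSum {d : ℕ} (p : ℝ) (s : Fin d → ℂ) (F : (Fin d → ℤ) → ℂ) (a : ℂ) : Prop :=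
  (∀ᶠ ε in 𝓝[>] (0 : ℝ), Summable fun m : Fin d → ℤ => F m * phiHat p ε (shifted m s)) ∧
  Tendsto (fun ε : ℝ => ∑' m : Fin d → ℤ, F m * phiHat p ε (shifted m s)) (𝓝[>] 0) (𝓝 a)

/-- `f` is the real-analytic continuation to all `t ∈ ℝ` of the function
`t ↦ (1_{tP})^(ξ)` of `t > 0`. -/
def IsTransformContinuation {d : ℕ} (P : Set (Fin d → ℝ)) (ξ : Fin d → ℂ) (f : ℝ → ℂ) : Prop :=
  AnalyticOnNhd ℝ f Set.univ ∧ ∀ t : ℝ, 0 < t → f t = indicatorHat (t • P) ξ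

/-- `a` is the value at `(t, s)` of the continuation of `A_P(t, s)` in `t`, that is of
`lim_{ε → 0+} ∑_{m} (1_{tP})^(m + s) φ̂_ε(m + s)` where each `(1_{tP})^(m + s)` is continued
real-analytically from `t > 0` to all `t ∈ ℝ`. -/
def HasContinuedSum {d : ℕ} (p : ℝ) (P : Set (Fin d → ℝ)) (t : ℝ) (s : Fin d → ℂ) (a : ℂ) :
    Prop :=
  ∃ E : (Fin d → ℤ) → ℝ → ℂ,
    (∀ m, IsTransformContinuation P (shifted m s) (E m)) ∧
    HasDampedSum p s (fun m => E m t) a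

/-- The tangent cone `K(v) = {c (x - v) : x ∈ P, c ≥ 0}` of `P` at `v`, moved to the origin. -/
def vertexCone {d : ℕ} (P : Set (Fin d → ℝ)) (v : Fin d → ℝ) : Set (Fin d → ℝ) :=
  {y | ∃ x ∈ P, ∃ c : ℝ, 0 ≤ c ∧ y = c • (x - v)}

/-- `w 1, …, w d` generate the simple `d`-cone `K` (with apex at the origin). -/
def GeneratesSimpleCone {d : ℕ} (K : Set (Fin d → ℝ)) (w : Fin d → Fin d → ℝ) : Prop :=
  LinearIndependent ℝ w ∧ K = {y | ∃ c : Fin d → ℝ, (∀ j, 0 ≤ c j) ∧ y = ∑ j, c j • w j}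

/-- `w v 1, …, w v d` are generators of the tangent cone at `v`, for every vertex `v` of `P`;
such a `w` exists precisely when the full-dimensional polytope `P` is simple. -/
def IsSimpleWith {d : ℕ} (P : Set (Fin d → ℝ)) (w : (Fin d → ℝ) → Fin d → Fin d → ℝ) : Prop :=
  ∀ v ∈ P.extremePoints ℝ, GeneratesSimpleCone (vertexCone P v) (w v)

/-- The parameters `s` for which no denominator `⟨w_j(v), m + s⟩` vanishes. -/
def admissible {d : ℕ} (P : Set (Fin d → ℝ)) (w : (Fin d → ℝ) → Fin d → Fin d → ℝ) :
    Set (Fin d → ℂ) :=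
  {s | ∀ v ∈ P.extremePoints ℝ, ∀ j, ∀ m : Fin d → ℤ, pairing (w v j) (shifted m s) ≠ 0}

/-- The sum over the vertices `v` of `P` of
`|det K(v)| exp(2πi t⟨v, ξ⟩) / ((-2πi)^d ∏_j ⟨w_j(v), ξ⟩)`. -/
def vertexTransform {d : ℕ} (P : Set (Fin d → ℝ)) (w : (Fin d → ℝ) → Fin d → Fin d → ℝ)
    (t : ℝ) (ξ : Fin d → ℂ) : ℂ :=
  ∑ᶠ v ∈ P.extremePoints ℝ,
    ((|(Matrix.of (w v)).det| : ℝ) : ℂ) / (-2 * Real.pi * Complex.I) ^ d *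
      (Complex.exp (2 * Real.pi * Complex.I * t * pairing v ξ) / ∏ j, pairing (w v j) ξ)

/-- `a` is the value at `(t, s)` of the vertex expression
`lim_{ε → 0+} ∑_m ∑_v (|det K(v)| / (-2πi)^d)
  exp(2πi t⟨v, m + s⟩) φ̂_ε(m + s) / ∏_j ⟨w_j(v), m + s⟩`. -/
def HasVertexSum {d : ℕ} (p : ℝ) (P : Set (Fin d → ℝ))
    (w : (Fin d → ℝ) → Fin d → Fin d → ℝ) (t : ℝ) (s : Fin d → ℂ) (a : ℂ) : Prop :=
  HasDampedSum p s (fun m => vertexTransform P w t (shifted m s)) a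

/-- `a` is the limit, as `s → 0` through admissible parameters, of the vertex expression at
`(t, s)`; the expression exists for every admissible `s`, and these accumulate at `0`. -/
def HasVertexSumAtZero {d : ℕ} (p : ℝ) (P : Set (Fin d → ℝ))
    (w : (Fin d → ℝ) → Fin d → Fin d → ℝ) (t : ℝ) (a : ℂ) : Prop :=
  0 ∈ closure (admissible P w) ∧
  ∃ A : (Fin d → ℂ) → ℂ,
    (∀ s ∈ admissible P w, HasVertexSum p P w t s (A s)) ∧
    Tendsto A (𝓝[admissible P w] 0) (𝓝 a)

end

end SolidAngle

/-! All three values vanish because the summands vanish one by one at `t = 0`. The dilate `0 • P` is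
a point, hence null in positive dimension, so every solid angle is 0. Substituting `t • x` for `x`,
the transform of `t • P` is `t ^ d` times an integral over `P` analytic in `t`, which is 0 at `t =
0`. For a simple polytope the summand at `t = 0` is a multiple of ∑_v |det w(v)| / ∏_j ℓ(w_j(v));
this is 0 by `sum_det_div_prod_eq_zero`: put tℓ into Brion's formula
`integral_exp_halfspaces_eq_sum`, multiply by t^d and let t → 0.

Brion's formula is obtained without integrating over unbounded cones. For small h, apply the product
of all differences 1 - T_{h w_j(v)}, over all vertices and generators, to the indicator of P.
Locally P is the cone of the constraints tight at some point of P. At a non-vertex this cone is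
invariant along some generator and is killed; at a vertex v the factors belonging to v cut it down
to a box. Hence `iterDiff_indicator_eq_sum`. Against exp ℓ each difference integrates to a scalar
factor 1 - exp(ℓ(h w_j(v))), nonzero for small h; the box integrals are explicit, and the factors of
the other vertices cancel. -/

namespace SolidAngle

/-! ### Iterated difference operators and their locality -/

section IterDiff

variable {ι E : Type*} [AddCommGroup E]

/-- The iterated difference `∏_{i ∈ s} (1 - T_{w i}) f`, where `T_u f = f (· - u)`. -/
def iterDiff (s : Finset ι) (w : ι → E) (f : E → ℂ) (y : E) : ℂ :=
  ∑ S ∈ s.powerset, (-1) ^ S.card * f (y - ∑ i ∈ S, w i)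

theorem iterDiff_empty (w : ι → E) (f : E → ℂ) : iterDiff ∅ w f = f := by
  funext y
  simp [iterDiff]

theorem iterDiff_insert [DecidableEq ι] {s : Finset ι} {i : ι} (hi : i ∉ s) (w : ι → E)
    (f : E → ℂ) (y : E) :
    iterDiff (insert i s) w f y = iterDiff s w f y - iterDiff s w f (y - w i) := by
  unfold iterDiff
  rw [Finset.sum_powerset_insert hi, sub_eq_add_neg, ← Finset.sum_neg_distrib]
  congr 1
  refine Finset.sum_congr rfl fun S hS => ?_
  have hiS : i ∉ S := fun h => hi (Finset.mem_powerset.1 hS h)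
  rw [Finset.card_insert_of_notMem hiS, Finset.sum_insert hiS, pow_succ, sub_sub]
  ring

/-- The operators commute, so the factor `1 - T_{w i}` may be taken last; it then subtracts two
equal values. -/
theorem iterDiff_eq_zero_of_invariant [DecidableEq ι] {s : Finset ι} {i : ι} (hi : i ∈ s)
    (w : ι → E) (f : E → ℂ) (hf : ∀ y, f (y - w i) = f y) : iterDiff s w f = 0 := by
  funext y
  rw [← Finset.insert_erase hi, iterDiff_insert (Finset.notMem_erase i s), Pi.zero_apply,
    sub_eq_zero]
  refine Finset.sum_congr rfl fun S _ => ?_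
  rw [sub_right_comm, hf]

theorem iterDiff_union [DecidableEq ι] {s t : Finset ι} (h : Disjoint s t) (w : ι → E)
    (f : E → ℂ) : iterDiff (s ∪ t) w f = iterDiff s w (iterDiff t w f) := by
  induction s using Finset.induction_on with
  | empty => rw [Finset.empty_union, iterDiff_empty]
  | insert i s hi ih =>
    rw [Finset.disjoint_insert_left] at h
    funext y
    rw [Finset.insert_union, iterDiff_insert (by simp [hi, h.1]), iterDiff_insert hi, ih h.2]

end IterDiff

theorem norm_sum_le_of_subset {ι E : Type*} [SeminormedAddCommGroup E] {s S : Finset ι}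
    (w : ι → E) (hS : S ∈ s.powerset) : ‖∑ i ∈ S, w i‖ ≤ ∑ i ∈ s, ‖w i‖ :=
  (norm_sum_le _ _).trans
    (Finset.sum_le_sum_of_subset_of_nonneg (Finset.mem_powerset.1 hS) fun _ _ _ => norm_nonneg _)

/-- Every translation involved is by a partial sum of the `w i`, so only values within the total
length matter. -/
theorem iterDiff_congr_of_ball {ι E : Type*} [SeminormedAddCommGroup E] {s : Finset ι}
    {w : ι → E} {f g : E → ℂ} {y : E} {r : ℝ} (hr : ∑ i ∈ s, ‖w i‖ < r)
    (h : ∀ x ∈ Metric.ball y r, f x = g x) : iterDiff s w f y = iterDiff s w g y := by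
  refine Finset.sum_congr rfl fun S hS => ?_
  rw [h]
  rw [Metric.mem_ball, dist_eq_norm, sub_sub_cancel_left, norm_neg]
  exact (norm_sum_le_of_subset w hS).trans_lt hr

theorem dist_le_of_iterDiff_ne_zero {ι E : Type*} [SeminormedAddCommGroup E] {s : Finset ι}
    {w : ι → E} {f : E → ℂ} {v y : E} {r : ℝ} (hf : ∀ x, f x ≠ 0 → dist x v ≤ r)
    (h : iterDiff s w f y ≠ 0) : dist y v ≤ ∑ i ∈ s, ‖w i‖ + r := by
  obtain ⟨S, hS, hne⟩ := Finset.exists_ne_zero_of_sum_ne_zero h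
  have h1 := hf _ (right_ne_zero_of_mul hne)
  have h2 := norm_sum_le_of_subset w hS
  have h3 : dist y (y - ∑ i ∈ S, w i) = ‖∑ i ∈ S, w i‖ := by
    rw [dist_eq_norm, sub_sub_cancel]
  linarith [dist_triangle y (y - ∑ i ∈ S, w i) v]

/-! ### Differences integrated against an exponential -/

section Integral

variable {d : ℕ} {ι : Type*}

theorem integrable_comp_sub_mul_exp (ℓ : (Fin d → ℝ) →L[ℝ] ℂ) {f : (Fin d → ℝ) → ℂ}
    (hf : Integrable fun y => f y * Complex.exp (ℓ y)) (u : Fin d → ℝ) :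
    Integrable (fun y => f (y - u) * Complex.exp (ℓ y)) ∧
    ∫ y, f (y - u) * Complex.exp (ℓ y) =
      Complex.exp (ℓ u) * ∫ y, f y * Complex.exp (ℓ y) := by
  have h : (fun y => f (y - u) * Complex.exp (ℓ y)) =
      fun y => Complex.exp (ℓ u) * (f (y - u) * Complex.exp (ℓ (y - u))) := by
    funext y
    rw [mul_left_comm, ← Complex.exp_add, ← map_add, add_sub_cancel]
  rw [h]
  refine ⟨(hf.comp_sub_right u).const_mul _, ?_⟩
  rw [integral_const_mul, integral_sub_right_eq_self (fun y => f y * Complex.exp (ℓ y)) u]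

theorem integral_iterDiff_mul_exp [DecidableEq ι] (ℓ : (Fin d → ℝ) →L[ℝ] ℂ) (s : Finset ι)
    (w : ι → Fin d → ℝ) {f : (Fin d → ℝ) → ℂ}
    (hf : Integrable fun y => f y * Complex.exp (ℓ y)) :
    Integrable (fun y => iterDiff s w f y * Complex.exp (ℓ y)) ∧
    ∫ y, iterDiff s w f y * Complex.exp (ℓ y) =
      (∏ i ∈ s, (1 - Complex.exp (ℓ (w i)))) * ∫ y, f y * Complex.exp (ℓ y) := by
  induction s using Finset.induction_on with
  | empty => simpa [iterDiff_empty] using hf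
  | insert i s hi ih =>
    have h := integrable_comp_sub_mul_exp ℓ ih.1 (w i)
    simp only [iterDiff_insert hi, sub_mul]
    refine ⟨ih.1.sub h.1, ?_⟩
    rw [integral_sub ih.1 h.1, h.2, ih.2, Finset.prod_insert hi]
    ring

end Integral

/-! ### Simple cones, boxes and their exponential integrals -/

section Box

variable {d : ℕ}

/-- The coordinates of `y` with respect to the basis `w`. -/
noncomputable def coords (w : Fin d → Fin d → ℝ) (y : Fin d → ℝ) : Fin d → ℝ :=
  ((Matrix.of w).transpose)⁻¹.mulVec y

theorem isUnit_det_of_linearIndependent {w : Fin d → Fin d → ℝ} (hw : LinearIndependent ℝ w) :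
    IsUnit (Matrix.of w).transpose.det := by
  rw [Matrix.det_transpose, ← Matrix.isUnit_iff_isUnit_det,
    ← Matrix.linearIndependent_rows_iff_isUnit]
  exact hw

theorem sum_smul_eq_mulVec (w : Fin d → Fin d → ℝ) (c : Fin d → ℝ) :
    ∑ j, c j • w j = (Matrix.of w).transpose.mulVec c := by
  funext k
  simp [Matrix.mulVec, dotProduct, mul_comm]

theorem coords_sum_smul {w : Fin d → Fin d → ℝ} (hw : LinearIndependent ℝ w) (c : Fin d → ℝ) :
    coords w (∑ j, c j • w j) = c := by
  rw [coords, sum_smul_eq_mulVec, Matrix.mulVec_mulVec,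
    Matrix.nonsing_inv_mul _ (isUnit_det_of_linearIndependent hw), Matrix.one_mulVec]

theorem sum_coords_smul {w : Fin d → Fin d → ℝ} (hw : LinearIndependent ℝ w) (y : Fin d → ℝ) :
    ∑ j, coords w y j • w j = y := by
  rw [coords, sum_smul_eq_mulVec, Matrix.mulVec_mulVec,
    Matrix.mul_nonsing_inv _ (isUnit_det_of_linearIndependent hw), Matrix.one_mulVec]

theorem coords_sub (w : Fin d → Fin d → ℝ) (x y : Fin d → ℝ) :
    coords w (x - y) = coords w x - coords w y :=
  Matrix.mulVec_sub _ _ _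

theorem mem_iff_coords_nonneg {w : Fin d → Fin d → ℝ} {K : Set (Fin d → ℝ)}
    (hK : GeneratesSimpleCone K w) (y : Fin d → ℝ) : y ∈ K ↔ ∀ j, 0 ≤ coords w y j := by
  rw [hK.2]
  constructor
  · rintro ⟨c, hc, rfl⟩
    rwa [coords_sum_smul hK.1]
  · exact fun h => ⟨coords w y, h, (sum_coords_smul hK.1 y).symm⟩

/-- The indicator function of the half-open box with edges `h • w j` at the apex `v`. -/
noncomputable def boxIndicator (h : ℝ) (v : Fin d → ℝ) (w : Fin d → Fin d → ℝ) (y : Fin d → ℝ) : ℂ :=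
  ∏ j, (Set.Ico 0 h).indicator 1 (coords w (y - v) j)

/-- In the coordinates of `w` the cone is a product of half-lines, and each difference turns [0, ∞)
into [0, h). -/
theorem iterDiff_cone {h : ℝ} (hh : 0 ≤ h) {v : Fin d → ℝ} {w : Fin d → Fin d → ℝ}
    {K : Set (Fin d → ℝ)} (hK : GeneratesSimpleCone K w) :
    iterDiff Finset.univ (fun j => h • w j) ({y | y - v ∈ K}.indicator 1) =
      boxIndicator h v w := by
  classical
  funext y
  have key : ∀ c : ℝ, (Set.Ico 0 h).indicator (1 : ℝ → ℂ) c =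
      (Set.Ici 0).indicator 1 c - (Set.Ici 0).indicator 1 (c - h) := by
    intro c
    by_cases h0 : 0 ≤ c
    · by_cases h1 : c < h
      · simp [Set.indicator, h0, h1, not_le.2 h1]
      · simp [Set.indicator, h0, h1, not_lt.1 h1]
    · have : ¬ h ≤ c := fun h2 => h0 (hh.trans h2)
      simp [Set.indicator, h0, this]
  -- Expanding the product of differences over subsets gives exactly the terms of `iterDiff`.
  simp only [boxIndicator, key, Finset.prod_sub, iterDiff]
  refine Finset.sum_congr rfl fun S _ => ?_
  rw [mul_assoc]
  congr 1
  have hc : coords w (y - ∑ i ∈ S, h • w i - v) =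
      coords w (y - v) - fun j => if j ∈ S then h else 0 := by
    have : ∑ i ∈ S, h • w i = ∑ j, (if j ∈ S then h else 0) • w j := by
      simp [Finset.sum_ite_mem, ite_smul]
    rw [sub_right_comm, coords_sub, this, coords_sum_smul hK.1]
  have h1 : {y | y - v ∈ K}.indicator (1 : (Fin d → ℝ) → ℂ) (y - ∑ i ∈ S, h • w i) =
      ∏ j, (Set.Ici 0).indicator 1 (coords w (y - v) j - if j ∈ S then h else 0) := by
    have h2 := mem_iff_coords_nonneg hK (y - ∑ i ∈ S, h • w i - v)
    rw [hc] at h2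
    by_cases h3 : y - ∑ i ∈ S, h • w i - v ∈ K
    · rw [Set.indicator_of_mem (by exact h3)]
      symm
      refine Finset.prod_eq_one fun j _ => ?_
      rw [Set.indicator_of_mem (by exact h2.1 h3 j), Pi.one_apply]
    · rw [Set.indicator_of_notMem (by exact h3)]
      obtain ⟨j, hj⟩ := not_forall.1 (mt h2.2 h3)
      symm
      refine Finset.prod_eq_zero (Finset.mem_univ j) ?_
      rw [Set.indicator_of_notMem (by exact hj)]
  rw [h1, ← Finset.prod_sdiff (Finset.subset_univ S)]
  congr 1
  · refine Finset.prod_congr rfl fun j hj => ?_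
    rw [if_neg (Finset.mem_sdiff.1 hj).2, sub_zero]
  · refine Finset.prod_congr rfl fun j hj => ?_
    rw [if_pos hj]

theorem dist_le_of_boxIndicator_ne_zero {h : ℝ} {v y : Fin d → ℝ} {w : Fin d → Fin d → ℝ}
    (hw : LinearIndependent ℝ w) (hy : boxIndicator h v w y ≠ 0) :
    dist y v ≤ ∑ j, ‖h • w j‖ := by
  rw [dist_eq_norm, ← sum_coords_smul hw (y - v)]
  refine (norm_sum_le _ _).trans (Finset.sum_le_sum fun j _ => ?_)
  have hj : coords w (y - v) j ∈ Set.Ico 0 h := by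
    by_contra hc
    exact hy (Finset.prod_eq_zero (Finset.mem_univ j) (Set.indicator_of_notMem hc _))
  rw [norm_smul, norm_smul, Real.norm_of_nonneg hj.1, Real.norm_of_nonneg (hj.1.trans hj.2.le)]
  exact mul_le_mul_of_nonneg_right hj.2.le (norm_nonneg _)

theorem integral_Ico_indicator_mul_exp {h : ℝ} (hh : 0 ≤ h) {z : ℂ} (hz : z ≠ 0) :
    ∫ c : ℝ, (Set.Ico 0 h).indicator 1 c * Complex.exp (z * c) = (Complex.exp (z * h) - 1) / z := by
  have h1 : (fun c : ℝ => (Set.Ico 0 h).indicator 1 c * Complex.exp (z * c)) =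
      (Set.Ico 0 h).indicator fun c : ℝ => Complex.exp (z * c) := by
    funext c
    by_cases hc : c ∈ Set.Ico 0 h <;> simp [hc]
  rw [h1, integral_indicator measurableSet_Ico, ← integral_Icc_eq_integral_Ico,
    integral_Icc_eq_integral_Ioc, ← intervalIntegral.integral_of_le hh, integral_exp_mul_complex hz]
  simp

/-- In the coordinates of `w` the integrand splits into one-dimensional factors; the Jacobian is
`|det w|`. -/
theorem integral_boxIndicator_mul_exp (ℓ : (Fin d → ℝ) →L[ℝ] ℂ) {h : ℝ} (hh : 0 ≤ h)
    (v : Fin d → ℝ) {w : Fin d → Fin d → ℝ} (hw : LinearIndependent ℝ w)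
    (hℓ : ∀ j, ℓ (w j) ≠ 0) :
    Integrable (fun y => boxIndicator h v w y * Complex.exp (ℓ y)) ∧
    ∫ y, boxIndicator h v w y * Complex.exp (ℓ y) =
      Complex.exp (ℓ v) * (|(Matrix.of w).det| *
        ∏ j, (Complex.exp (ℓ (h • w j)) - 1) / ℓ (w j)) := by
  set F : (Fin d → ℝ) → ℂ := fun c =>
    ∏ j, ((Set.Ico 0 h).indicator 1 (c j) * Complex.exp (ℓ (w j) * c j)) with hF
  have hdet := isUnit_det_of_linearIndependent hw
  have hA : ((Matrix.of w).transpose)⁻¹.det ≠ 0 := by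
    rw [Matrix.det_nonsing_inv, Ring.inverse_eq_inv']
    exact inv_ne_zero hdet.ne_zero
  have hmap := Real.map_matrix_volume_pi_eq_smul_volume_pi hA
  rw [Matrix.det_nonsing_inv, Ring.inverse_eq_inv', inv_inv, Matrix.det_transpose] at hmap
  have hme : Measurable (Matrix.toLin' ((Matrix.of w).transpose)⁻¹) :=
    (LinearMap.continuous_of_finiteDimensional _).measurable
  have hFint : Integrable F := by
    refine Integrable.fintype_prod (μ := fun _ => volume)
      (f := fun j c => (Set.Ico 0 h).indicator 1 c * Complex.exp (ℓ (w j) * c)) fun j => ?_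
    have h1 : (fun c : ℝ => (Set.Ico 0 h).indicator 1 c * Complex.exp (ℓ (w j) * c)) =
      (Set.Ico 0 h).indicator fun c : ℝ => Complex.exp (ℓ (w j) * c) := by
      funext c
      by_cases hc : c ∈ Set.Ico 0 h <;> simp [hc]
    rw [h1, integrable_indicator_iff measurableSet_Ico]
    exact (ContinuousOn.integrableOn_compact isCompact_Icc
      (by fun_prop)).mono_set Set.Ico_subset_Icc_self
  have hFint' : Integrable F
      (Measure.map (Matrix.toLin' ((Matrix.of w).transpose)⁻¹) volume) := by
    rw [hmap]
    exact hFint.smul_measure ENNReal.ofReal_ne_top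
  have hcomp : Integrable fun y => F (coords w y) :=
    (integrable_map_measure hFint'.aestronglyMeasurable hme.aemeasurable).1 hFint'
  have hintF : ∫ y, F (coords w y) = |(Matrix.of w).det| *
      ∏ j, (Complex.exp (ℓ (h • w j)) - 1) / ℓ (w j) := by
    have h1 := integral_map (μ := volume) hme.aemeasurable hFint'.aestronglyMeasurable
    rw [hmap, integral_smul_measure, ENNReal.toReal_ofReal (abs_nonneg _)] at h1
    refine h1.symm.trans ?_
    rw [Complex.real_smul, hF, integral_fintype_prod_volume_eq_prod
      (fun j c => (Set.Ico 0 h).indicator 1 c * Complex.exp (ℓ (w j) * c))]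
    congr 1
    refine Finset.prod_congr rfl fun j _ => ?_
    rw [integral_Ico_indicator_mul_exp hh (hℓ j), map_smul, Complex.real_smul, mul_comm (h : ℂ)]
  have heq : (fun y => boxIndicator h v w y * Complex.exp (ℓ y)) =
      fun y => Complex.exp (ℓ v) * F (coords w (y - v)) := by
    funext y
    rw [hF]
    simp only [boxIndicator, Finset.prod_mul_distrib, ← Complex.exp_sum]
    rw [mul_left_comm, ← Complex.exp_add]
    congr 2
    have : ℓ (y - v) = ∑ j, ℓ (w j) * (coords w (y - v) j : ℂ) := by
      conv_lhs => rw [← sum_coords_smul hw (y - v)]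
      simp [mul_comm]
    rw [← this, map_sub, add_sub_cancel]
  rw [heq]
  refine ⟨(hcomp.comp_sub_right v).const_mul _, ?_⟩
  rw [integral_const_mul, integral_sub_right_eq_self (fun y => F (coords w y)) v, hintF]

end Box

/-! ### Local structure of a polyhedron: tight cones and vertices -/

section Halfspaces

variable {d n : ℕ}

/-- The points whose pairings with `a i` do not exceed `b i`. -/
def halfspaces (a : Fin n → Fin d → ℝ) (b : Fin n → ℝ) : Set (Fin d → ℝ) :=
  {x | ∀ i, a i ⬝ᵥ x ≤ b i}

/-- The points satisfying the constraints that are tight at `x`. -/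
def tightCone (a : Fin n → Fin d → ℝ) (b : Fin n → ℝ) (x : Fin d → ℝ) : Set (Fin d → ℝ) :=
  {y | ∀ i, a i ⬝ᵥ x = b i → a i ⬝ᵥ y ≤ b i}

/-- The points satisfying strictly the constraints that are slack at `x`. -/
def slackNhd (a : Fin n → Fin d → ℝ) (b : Fin n → ℝ) (x : Fin d → ℝ) : Set (Fin d → ℝ) :=
  {y | ∀ i, a i ⬝ᵥ x < b i → a i ⬝ᵥ y < b i}

variable {a : Fin n → Fin d → ℝ} {b : Fin n → ℝ} {x y v : Fin d → ℝ}

theorem continuous_dotProduct_left (u : Fin d → ℝ) : Continuous fun y : Fin d → ℝ => u ⬝ᵥ y := by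
  unfold dotProduct
  fun_prop

theorem isOpen_slackNhd : IsOpen (slackNhd a b x) := by
  simp only [slackNhd, Set.ofPred_forall]
  exact isOpen_iInter_of_finite fun i => isOpen_iInter_of_finite fun _ =>
    isOpen_lt (continuous_dotProduct_left _) continuous_const

theorem isClosed_halfspaces : IsClosed (halfspaces a b) := by
  simp only [halfspaces, Set.ofPred_forall]
  exact isClosed_iInter fun i => isClosed_le (continuous_dotProduct_left _) continuous_const

theorem mem_slackNhd_self : x ∈ slackNhd a b x := fun _ => id

theorem mem_halfspaces_iff (hx : x ∈ halfspaces a b) (hy : y ∈ slackNhd a b x) :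
    y ∈ halfspaces a b ↔ y ∈ tightCone a b x :=
  ⟨fun h i _ => h i, fun h i => (hx i).lt_or_eq.elim (fun h' => (hy i h').le) (h i)⟩

theorem exists_pos_mem_slackNhd (a : Fin n → Fin d → ℝ) (b : Fin n → ℝ) (x u : Fin d → ℝ) :
    ∃ ε > 0, ∀ t : ℝ, |t| ≤ ε → x + t • u ∈ slackNhd a b x := by
  have hc : ContinuousAt (fun t : ℝ => x + t • u) 0 := by fun_prop
  have hn : slackNhd a b x ∈ 𝓝 (x + (0 : ℝ) • u) := by
    rw [zero_smul, add_zero]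
    exact isOpen_slackNhd.mem_nhds mem_slackNhd_self
  obtain ⟨ε, hε, h⟩ := Metric.mem_nhds_iff.1 (hc hn)
  refine ⟨ε / 2, half_pos hε, fun t ht => h ?_⟩
  rw [Metric.mem_ball, Real.dist_eq, sub_zero]
  exact ht.trans_lt (half_lt_self hε)

/-- The tight constraints determine a vertex: otherwise one could move from `v` both ways along `x -
v` inside the polyhedron. -/
theorem eq_of_mem_extremePoints (hv : v ∈ (halfspaces a b).extremePoints ℝ)
    (hx : ∀ i, a i ⬝ᵥ v = b i → a i ⬝ᵥ x = b i) : x = v := by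
  obtain ⟨ε, hε, h⟩ := exists_pos_mem_slackNhd a b v (x - v)
  have hmem : ∀ t : ℝ, |t| ≤ ε → v + t • (x - v) ∈ halfspaces a b := by
    refine fun t ht => (mem_halfspaces_iff hv.1 (h t ht)).2 fun i hi => le_of_eq ?_
    rw [dotProduct_add, dotProduct_smul, dotProduct_sub, hx i hi, hi, sub_self, smul_zero, add_zero]
  have hseg : v ∈ openSegment ℝ (v + ε • (x - v)) (v + (-ε) • (x - v)) :=
    ⟨1 / 2, 1 / 2, by norm_num, by norm_num, by norm_num, by module⟩
  have := (mem_extremePoints.1 hv).2 _ (hmem ε (abs_of_pos hε).le) _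
    (hmem (-ε) (by rw [abs_neg, abs_of_pos hε])) hseg
  have h0 : ε • (x - v) = 0 := by simpa using this.1
  exact sub_eq_zero.1 ((smul_eq_zero.1 h0).resolve_left hε.ne')

theorem finite_extremePoints_halfspaces (a : Fin n → Fin d → ℝ) (b : Fin n → ℝ) :
    ((halfspaces a b).extremePoints ℝ).Finite := by
  refine Set.Finite.of_finite_image (f := fun v => {i | a i ⬝ᵥ v = b i}) (Set.toFinite _) ?_
  intro v hv x _ hvx
  refine (eq_of_mem_extremePoints hv fun i hi => ?_).symm
  exact (Set.ext_iff.1 hvx i).1 hi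

theorem mem_tightCone_iff (hv : v ∈ halfspaces a b) :
    y ∈ tightCone a b v ↔ y - v ∈ vertexCone (halfspaces a b) v := by
  constructor
  · intro hy
    obtain ⟨ε, hε, h⟩ := exists_pos_mem_slackNhd a b v (y - v)
    refine ⟨v + ε • (y - v), ?_, ε⁻¹, (inv_pos.2 hε).le, ?_⟩
    · refine (mem_halfspaces_iff hv (h ε (abs_of_pos hε).le)).2 fun i hi => ?_
      rw [dotProduct_add, dotProduct_smul, dotProduct_sub, hi, smul_eq_mul]
      nlinarith [hy i hi]
    · rw [add_sub_cancel_left, inv_smul_smul₀ hε.ne']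
  · rintro ⟨x, hx, c, hc, h⟩ i hi
    rw [eq_add_of_sub_eq h, dotProduct_add, dotProduct_smul, dotProduct_sub, hi, smul_eq_mul]
    nlinarith [hx i]

/-- This supplies the direction along which the tight cone of a non-vertex is invariant: an edge
direction at a vertex of the smallest face containing `x`. -/
theorem exists_generator_of_notMem_extremePoints
    (hP : Bornology.IsBounded (halfspaces a b)) {w : (Fin d → ℝ) → Fin d → Fin d → ℝ}
    (hw : IsSimpleWith (halfspaces a b) w) (hx : x ∈ halfspaces a b)
    (hx' : x ∉ (halfspaces a b).extremePoints ℝ) :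
    ∃ v ∈ (halfspaces a b).extremePoints ℝ, ∃ j, ∀ i, a i ⬝ᵥ x = b i → a i ⬝ᵥ w v j = 0 := by
  -- The smallest face containing `x`; being compact, it has an extreme point `v`, which is a vertex
  -- of the polytope.
  set F : Set (Fin d → ℝ) := {y ∈ halfspaces a b | ∀ i, a i ⬝ᵥ x = b i → a i ⬝ᵥ y = b i} with hF
  have hFsub : F ⊆ halfspaces a b := fun y hy => hy.1
  have hext : IsExtreme ℝ (halfspaces a b) F := by
    refine ⟨hFsub, fun y hy z hz u hu huyz => ⟨hy, fun i hi => ?_⟩⟩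
    obtain ⟨α, β, hα, hβ, hαβ, rfl⟩ := huyz
    have h1 := hu.2 i hi
    rw [dotProduct_add, dotProduct_smul, dotProduct_smul, smul_eq_mul, smul_eq_mul] at h1
    have h2 := hz i
    refine le_antisymm (hy i) (not_lt.1 fun h3 => ?_)
    have h4 : b i = α * b i + β * b i := by rw [← add_mul, hαβ, one_mul]
    nlinarith
  have hcomp : IsCompact F := by
    refine Metric.isCompact_of_isClosed_isBounded ?_ (hP.subset hFsub)
    have : F = halfspaces a b ∩ ⋂ i, ⋂ _ : a i ⬝ᵥ x = b i, {y | a i ⬝ᵥ y = b i} := by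
      ext y
      simp [hF]
    rw [this]
    exact isClosed_halfspaces.inter (isClosed_iInter fun i => isClosed_iInter fun _ =>
      isClosed_eq (continuous_dotProduct_left _) continuous_const)
  have hxF : x ∈ F := ⟨hx, fun _ => id⟩
  obtain ⟨v, hvF⟩ := hcomp.extremePoints_nonempty ⟨x, hxF⟩
  have hv := hext.extremePoints_subset_extremePoints hvF
  have hne : x ≠ v := fun h => hx' (h ▸ hv)
  have hgen := hw v hv
  have hK : x - v ∈ vertexCone (halfspaces a b) v := ⟨x, hx, 1, zero_le_one, (one_smul _ _).symm⟩
  have hwK : ∀ j, w v j ∈ vertexCone (halfspaces a b) v := by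
    intro j
    rw [hgen.2]
    exact ⟨Pi.single j 1, fun k => by by_cases h : k = j <;> simp [h],
      by simp [Pi.single_apply]⟩
  rw [hgen.2] at hK
  obtain ⟨c, hc, hxv⟩ := hK
  obtain ⟨j, hj⟩ : ∃ j, c j ≠ 0 := by
    by_contra! h
    exact hne (sub_eq_zero.1 (by simpa [h] using hxv))
  -- A constraint tight at `x` is nonpositive on all generators at `v` and zero on their nonnegative
  -- combination `x - v`, so it is zero on each generator with nonzero coefficient.
  refine ⟨v, hv, j, fun i hi => ?_⟩
  have hvi : a i ⬝ᵥ v = b i := hvF.1.2 i hi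
  have hle : ∀ k, a i ⬝ᵥ w v k ≤ 0 := by
    intro k
    have h1 : v + w v k ∈ tightCone a b v :=
      (mem_tightCone_iff hv.1).2 (by simpa using hwK k)
    have h2 := h1 i hvi
    rw [dotProduct_add, hvi] at h2
    linarith
  have hsum : ∑ k, c k * (a i ⬝ᵥ w v k) = 0 := by
    have h1 : a i ⬝ᵥ (x - v) = 0 := by rw [dotProduct_sub, hi, hvi, sub_self]
    rw [hxv, dotProduct_sum] at h1
    simpa [dotProduct_smul] using h1
  have h3 := (Finset.sum_eq_zero_iff_of_nonpos fun k _ =>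
    mul_nonpos_of_nonneg_of_nonpos (hc k) (hle k)).1 hsum j (Finset.mem_univ j)
  exact (mul_eq_zero.1 h3).resolve_left hj

theorem iterDiff_tightCone_eq_zero {ι : Type*} [DecidableEq ι] {s : Finset ι}
    {w : ι → Fin d → ℝ} {i : ι} (hi : i ∈ s) (h : ∀ k, a k ⬝ᵥ x = b k → a k ⬝ᵥ w i = 0) :
    iterDiff s w ((tightCone a b x).indicator 1) = 0 := by
  classical
  refine iterDiff_eq_zero_of_invariant hi w _ fun y => ?_
  have : y - w i ∈ tightCone a b x ↔ y ∈ tightCone a b x :=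
    forall₂_congr fun k hk => by rw [dotProduct_sub, h k hk, sub_zero]
  simp only [Set.indicator_apply, this, Pi.one_apply]

end Halfspaces

/-! ### Brion's theorem and its limit under scaling -/

section Brion

theorem iterDiff_map {ι κ E : Type*} [AddCommGroup E] (e : κ ↪ ι) (s : Finset κ) (w : ι → E)
    (f : E → ℂ) : iterDiff (s.map e) w f = iterDiff s (w ∘ e) f := by
  classical
  induction s using Finset.induction_on with
  | empty => rw [Finset.map_empty, iterDiff_empty, iterDiff_empty]
  | insert i s hi ih =>
    funext y
    rw [Finset.map_insert, iterDiff_insert (by simpa using hi), iterDiff_insert hi, ih]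
    rfl

variable {d n : ℕ} {a : Fin n → Fin d → ℝ} {b : Fin n → ℝ}

/-- A Lebesgue number of the cover by slack neighbourhoods: one scale at which the polytope looks
like a tight cone everywhere. -/
theorem exists_uniform_slackNhd (hP : Bornology.IsBounded (halfspaces a b)) :
    ∃ δ > 0, ∀ x ∈ halfspaces a b, ∃ x' ∈ halfspaces a b,
      Metric.ball x δ ⊆ slackNhd a b x' := by
  obtain ⟨δ, hδ, h⟩ := lebesgue_number_lemma_of_metric
    (c := fun x : halfspaces a b => slackNhd a b x)
    (Metric.isCompact_of_isClosed_isBounded isClosed_halfspaces hP)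
    (fun _ => isOpen_slackNhd) (fun x hx => Set.mem_iUnion.2 ⟨⟨x, hx⟩, mem_slackNhd_self⟩)
  exact ⟨δ, hδ, fun x hx => let ⟨i, hi⟩ := h x hx; ⟨i, i.2, hi⟩⟩

/-- The derivative at 0 is `z ≠ 0`, so the curve leaves the value 1 at once. -/
theorem eventually_exp_smul_ne_one {z : ℂ} (hz : z ≠ 0) :
    ∀ᶠ h : ℝ in 𝓝[>] 0, Complex.exp (h • z) ≠ 1 := by
  have h1 : HasDerivAt (fun h : ℝ => Complex.exp (h • z)) z 0 := by
    have := ((hasDerivAt_id (0 : ℝ)).smul_const z).cexp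
    simpa using this
  exact nhdsWithin_mono _ (fun _ hx => (Set.mem_Ioi.1 hx).ne') (h1.eventually_ne hz)

/-- The pairs of a vertex of the polytope and an index of a generator of its tangent cone. -/
noncomputable def generatorIndices (a : Fin n → Fin d → ℝ) (b : Fin n → ℝ) :
    Finset ((Fin d → ℝ) × Fin d) :=
  (finite_extremePoints_halfspaces a b).toFinset ×ˢ Finset.univ

/-- The pairs in `generatorIndices` that belong to the vertex `v`. -/
def generatorIndicesAt (v : Fin d → ℝ) : Finset ((Fin d → ℝ) × Fin d) :=
  Finset.univ.map (Function.Embedding.sectR v (Fin d))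

theorem mem_generatorIndices {i : (Fin d → ℝ) × Fin d} :
    i ∈ generatorIndices a b ↔ i.1 ∈ (halfspaces a b).extremePoints ℝ := by
  simp [generatorIndices]

theorem generatorIndicesAt_subset {v : Fin d → ℝ} (hv : v ∈ (halfspaces a b).extremePoints ℝ) :
    generatorIndicesAt v ⊆ generatorIndices a b := by
  intro i hi
  obtain ⟨j, -, rfl⟩ := Finset.mem_map.1 hi
  exact mem_generatorIndices.2 hv

open Classical in
theorem iterDiff_tightCone_of_mem_extremePoints {w : (Fin d → ℝ) → Fin d → Fin d → ℝ}
    (hw : IsSimpleWith (halfspaces a b) w) {v : Fin d → ℝ}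
    (hv : v ∈ (halfspaces a b).extremePoints ℝ) {h : ℝ} (hh : 0 ≤ h) :
    iterDiff (generatorIndices a b) (fun i => h • w i.1 i.2) ((tightCone a b v).indicator 1) =
      iterDiff (generatorIndices a b \ generatorIndicesAt v) (fun i => h • w i.1 i.2)
        (boxIndicator h v (w v)) := by
  conv_lhs => rw [← Finset.sdiff_union_of_subset (generatorIndicesAt_subset hv)]
  rw [iterDiff_union Finset.sdiff_disjoint, generatorIndicesAt, iterDiff_map,
    ← iterDiff_cone hh (hw v hv)]
  have : tightCone a b v = {y | y - v ∈ vertexCone (halfspaces a b) v} :=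
    Set.ext fun y => mem_tightCone_iff hv.1
  rw [this]
  rfl

-- Small shifts reduce the claim at `y` to a single tight cone, and only the box of a vertex equal
-- to its base point can reach `y`.
open Classical in
theorem iterDiff_indicator_eq_sum {w : (Fin d → ℝ) → Fin d → Fin d → ℝ}
    (hP : Bornology.IsBounded (halfspaces a b)) (hw : IsSimpleWith (halfspaces a b) w) :
    ∀ᶠ h : ℝ in 𝓝[>] 0, ∀ y,
      iterDiff (generatorIndices a b) (fun i => h • w i.1 i.2) ((halfspaces a b).indicator 1) y =
      ∑ v ∈ (finite_extremePoints_halfspaces a b).toFinset,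
        iterDiff (generatorIndices a b \ generatorIndicesAt v) (fun i => h • w i.1 i.2)
          (boxIndicator h v (w v)) y := by
  obtain ⟨δ, hδ, hball⟩ := exists_uniform_slackNhd hP
  have hsmall : ∀ᶠ h : ℝ in 𝓝[>] 0,
      ∑ i ∈ generatorIndices a b, ‖h • w i.1 i.2‖ < δ / 4 := by
    have hc : Tendsto (fun h : ℝ => ∑ i ∈ generatorIndices a b, ‖h • w i.1 i.2‖) (𝓝 0) (𝓝 0) := by
      have : Continuous fun h : ℝ => ∑ i ∈ generatorIndices a b, ‖h • w i.1 i.2‖ := by fun_prop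
      simpa using this.tendsto 0
    exact (hc.mono_left nhdsWithin_le_nhds).eventually_lt_const (by positivity)
  filter_upwards [hsmall, self_mem_nhdsWithin] with h hr hh y
  have hh0 : 0 ≤ h := le_of_lt hh
  have hnear : ∀ v ∈ (halfspaces a b).extremePoints ℝ,
      iterDiff (generatorIndices a b \ generatorIndicesAt v) (fun i => h • w i.1 i.2)
        (boxIndicator h v (w v)) y ≠ 0 → dist y v < δ / 2 := by
    intro v hv hne
    have h1 := dist_le_of_iterDiff_ne_zero
      (fun x => dist_le_of_boxIndicator_ne_zero (hw v hv).1) hne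
    have h2 : ∑ j, ‖h • w v j‖ = ∑ i ∈ generatorIndicesAt v, ‖h • w i.1 i.2‖ := by
      simp [generatorIndicesAt]
    rw [h2, Finset.sum_sdiff (generatorIndicesAt_subset hv)] at h1
    linarith
  -- Farther than this from the polytope both sides vanish, as all shifts and boxes together extend
  -- less than δ / 4.
  by_cases hy : ∃ x ∈ halfspaces a b, dist x y < δ / 2
  · obtain ⟨x, hx, hxy⟩ := hy
    obtain ⟨x', hx', hsub⟩ := hball x hx
    have hsub' : Metric.ball y (δ / 2) ⊆ slackNhd a b x' :=
      (Metric.ball_subset_ball' (by rw [dist_comm]; linarith)).trans hsub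
    have hloc : iterDiff (generatorIndices a b) (fun i => h • w i.1 i.2)
        ((halfspaces a b).indicator 1) y =
        iterDiff (generatorIndices a b) (fun i => h • w i.1 i.2)
        ((tightCone a b x').indicator 1) y := by
      refine iterDiff_congr_of_ball (r := δ / 2) (by linarith) fun z hz => ?_
      simp only [Set.indicator_apply, mem_halfspaces_iff hx' (hsub' hz)]
    -- A vertex `v` this close is in the slack neighbourhood of `x'`, so constraints tight at `v`
    -- are tight at `x'`.
    have honly : ∀ v ∈ (halfspaces a b).extremePoints ℝ,
        iterDiff (generatorIndices a b \ generatorIndicesAt v) (fun i => h • w i.1 i.2)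
          (boxIndicator h v (w v)) y ≠ 0 → x' = v := by
      intro v hv hne
      have hvs : v ∈ slackNhd a b x' := hsub' (by
        rw [Metric.mem_ball, dist_comm]
        exact hnear v hv hne)
      refine eq_of_mem_extremePoints hv fun i hi => ?_
      by_contra hlt
      exact (hvs i (lt_of_le_of_ne (hx' i) hlt)).ne hi
    rw [hloc]
    by_cases hext : x' ∈ (halfspaces a b).extremePoints ℝ
    · rw [iterDiff_tightCone_of_mem_extremePoints hw hext hh0]
      symm
      refine Finset.sum_eq_single_of_mem x' ((Set.Finite.mem_toFinset _).2 hext)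
        fun v hv hne => ?_
      by_contra h0
      exact hne (honly v ((Set.Finite.mem_toFinset _).1 hv) h0).symm
    · obtain ⟨v, hv, j, hj⟩ := exists_generator_of_notMem_extremePoints hP hw hx' hext
      rw [iterDiff_tightCone_eq_zero (i := (v, j)) (mem_generatorIndices.2 hv) fun k hk => by
        rw [dotProduct_smul, hj k hk, smul_zero]]
      refine (Finset.sum_eq_zero fun u hu => ?_).symm
      by_contra h0
      have hu' := (Set.Finite.mem_toFinset _).1 hu
      exact hext (honly u hu' h0 ▸ hu')
  · push Not at hy
    rw [iterDiff_congr_of_ball (g := 0) (r := δ / 2) (by linarith) fun z hz =>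
      Set.indicator_of_notMem (fun hzP => (hy z hzP).not_gt hz) _]
    trans 0
    · simp [iterDiff]
    · refine (Finset.sum_eq_zero fun v hv => ?_).symm
      by_contra h0
      have hv' := (Set.Finite.mem_toFinset _).1 hv
      have := hnear v hv' h0
      rw [dist_comm] at this
      exact (hy v hv'.1).not_gt this

/-- **Brion's theorem** for a simple polytope. -/
theorem integral_exp_halfspaces_eq_sum {w : (Fin d → ℝ) → Fin d → Fin d → ℝ}
    (hP : Bornology.IsBounded (halfspaces a b)) (hw : IsSimpleWith (halfspaces a b) w)
    (ℓ : (Fin d → ℝ) →L[ℝ] ℂ)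
    (hℓ : ∀ v ∈ (halfspaces a b).extremePoints ℝ, ∀ j, ℓ (w v j) ≠ 0) :
    ∫ y in halfspaces a b, Complex.exp (ℓ y) =
      (-1) ^ d * ∑ v ∈ (finite_extremePoints_halfspaces a b).toFinset,
        |(Matrix.of (w v)).det| * (Complex.exp (ℓ v) / ∏ j, ℓ (w v j)) := by
  classical
  have hexp : ∀ᶠ h : ℝ in 𝓝[>] 0, ∀ i ∈ generatorIndices a b,
      Complex.exp (h • ℓ (w i.1 i.2)) ≠ 1 :=
    (Filter.eventually_all_finset _).2 fun i hi =>
      eventually_exp_smul_ne_one (hℓ _ (mem_generatorIndices.1 hi) _)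
  obtain ⟨h, ⟨hpt, hne⟩, hh⟩ :=
    (((iterDiff_indicator_eq_sum hP hw).and hexp).and self_mem_nhdsWithin).exists
  have hh0 : 0 ≤ h := le_of_lt hh
  have hcomp : IsCompact (halfspaces a b) :=
    Metric.isCompact_of_isClosed_isBounded isClosed_halfspaces hP
  have hind : (fun y => (halfspaces a b).indicator 1 y * Complex.exp (ℓ y)) =
      (halfspaces a b).indicator fun y => Complex.exp (ℓ y) := by
    funext y
    by_cases hy : y ∈ halfspaces a b <;> simp [hy]
  have hint : Integrable fun y => (halfspaces a b).indicator 1 y * Complex.exp (ℓ y) := by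
    rw [hind, integrable_indicator_iff isClosed_halfspaces.measurableSet]
    exact ContinuousOn.integrableOn_compact hcomp (by fun_prop)
  -- The common factor produced by all differences, to be cancelled at the end.
  set D : ℂ := ∏ i ∈ generatorIndices a b, (1 - Complex.exp (ℓ (h • w i.1 i.2))) with hD
  have hD0 : D ≠ 0 := Finset.prod_ne_zero_iff.2 fun i hi => by
    rw [map_smul]
    exact sub_ne_zero.2 (hne i hi).symm
  have hvert : ∀ v ∈ (finite_extremePoints_halfspaces a b).toFinset,
      Integrable (fun y => iterDiff (generatorIndices a b \ generatorIndicesAt v)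
        (fun i => h • w i.1 i.2) (boxIndicator h v (w v)) y * Complex.exp (ℓ y)) ∧
      ∫ y, iterDiff (generatorIndices a b \ generatorIndicesAt v)
        (fun i => h • w i.1 i.2) (boxIndicator h v (w v)) y * Complex.exp (ℓ y) =
      D * ((-1) ^ d * (|(Matrix.of (w v)).det| * (Complex.exp (ℓ v) / ∏ j, ℓ (w v j)))) := by
    intro v hv
    rw [Set.Finite.mem_toFinset] at hv
    have hbox := integral_boxIndicator_mul_exp ℓ hh0 v (hw v hv).1 (hℓ v hv)
    have hdiff := integral_iterDiff_mul_exp ℓ (generatorIndices a b \ generatorIndicesAt v)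
      (fun i => h • w i.1 i.2) hbox.1
    refine ⟨hdiff.1, ?_⟩
    rw [hdiff.2, hbox.2, hD, ← Finset.prod_sdiff (generatorIndicesAt_subset hv)]
    -- The box integral at `v` supplies the factors of `D` that belong to `v`, up to the sign
    -- (-1)^d.
    have h1 : ∏ i ∈ generatorIndicesAt v, (1 - Complex.exp (ℓ (h • w i.1 i.2))) =
        (-1) ^ d * ∏ j, (Complex.exp (ℓ (h • w v j)) - 1) := by
      have h3 : ((-1 : ℂ)) ^ d = ∏ _j : Fin d, (-1 : ℂ) := by simp
      rw [generatorIndicesAt, Finset.prod_map, h3, ← Finset.prod_mul_distrib]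
      refine Finset.prod_congr rfl fun j _ => ?_
      rw [neg_one_mul, neg_sub]
      rfl
    have h2 : ((-1 : ℂ) ^ d) * (-1) ^ d = 1 := by rw [← mul_pow]; simp
    rw [h1, Finset.prod_div_distrib]
    linear_combination (-(∏ i ∈ generatorIndices a b \ generatorIndicesAt v,
      (1 - Complex.exp (ℓ (h • w i.1 i.2)))) * Complex.exp (ℓ v) *
      ((|(Matrix.of (w v)).det| : ℝ) : ℂ) *
      ((∏ j, (Complex.exp (ℓ (h • w v j)) - 1)) / ∏ j, ℓ (w v j))) * h2
  have hmain := (integral_iterDiff_mul_exp ℓ (generatorIndices a b)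
    (fun i => h • w i.1 i.2) hint).2
  simp only [hpt, Finset.sum_mul] at hmain
  rw [integral_finsetSum _ fun v hv => (hvert v hv).1,
    Finset.sum_congr rfl fun v hv => (hvert v hv).2, ← Finset.mul_sum, ← Finset.mul_sum, hind,
    integral_indicator isClosed_halfspaces.measurableSet] at hmain
  exact (mul_left_cancel₀ hD0 hmain).symm

/-- Brion's formula for tℓ has denominators homogeneous of degree d in t. After multiplication by
t^d both sides are continuous, and at t = 0 the integral side vanishes. -/
theorem sum_det_div_prod_eq_zero (hd : d ≠ 0) {w : (Fin d → ℝ) → Fin d → Fin d → ℝ}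
    (hP : Bornology.IsBounded (halfspaces a b)) (hw : IsSimpleWith (halfspaces a b) w)
    (ℓ : (Fin d → ℝ) →L[ℝ] ℂ)
    (hℓ : ∀ v ∈ (halfspaces a b).extremePoints ℝ, ∀ j, ℓ (w v j) ≠ 0) :
    ∑ v ∈ (finite_extremePoints_halfspaces a b).toFinset,
      |(Matrix.of (w v)).det| * (1 / ∏ j, ℓ (w v j)) = 0 := by
  have hcomp : IsCompact (halfspaces a b) :=
    Metric.isCompact_of_isClosed_isBounded isClosed_halfspaces hP
  have hF : Continuous fun t : ℝ =>
      (t : ℂ) ^ d * ∫ y in halfspaces a b, Complex.exp (t * ℓ y) := by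
    refine (by fun_prop : Continuous fun t : ℝ => (t : ℂ) ^ d).mul ?_
    exact continuous_parametric_integral_of_continuous
      (f := fun (t : ℝ) y => Complex.exp (t * ℓ y)) (by fun_prop) hcomp
  have hG : Continuous fun t : ℝ =>
      (-1) ^ d * ∑ v ∈ (finite_extremePoints_halfspaces a b).toFinset,
        |(Matrix.of (w v)).det| * (Complex.exp (t * ℓ v) / ∏ j, ℓ (w v j)) := by
    fun_prop
  have heq : ∀ t : ℝ, t ≠ 0 → (t : ℂ) ^ d * ∫ y in halfspaces a b, Complex.exp (t * ℓ y) =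
      (-1) ^ d * ∑ v ∈ (finite_extremePoints_halfspaces a b).toFinset,
        |(Matrix.of (w v)).det| * (Complex.exp (t * ℓ v) / ∏ j, ℓ (w v j)) := by
    intro t ht
    have ht' : (t : ℂ) ^ d ≠ 0 := pow_ne_zero _ (Complex.ofReal_ne_zero.2 ht)
    have h1 := integral_exp_halfspaces_eq_sum hP hw (t • ℓ) fun v hv j => by
      rw [smul_apply]
      exact smul_ne_zero ht (hℓ v hv j)
    simp only [smul_apply, Complex.real_smul, Finset.prod_mul_distrib,
      Finset.prod_const, Finset.card_univ, Fintype.card_fin] at h1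
    rw [h1, mul_left_comm, Finset.mul_sum]
    congr 1
    refine Finset.sum_congr rfl fun v _ => ?_
    rw [mul_left_comm, ← div_div, div_right_comm, mul_div_cancel₀ _ ht']
  have h0 := congr_fun (Continuous.ext_on (dense_compl_singleton (0 : ℝ)) hF hG
    fun t ht => heq t ht) 0
  simp only [Complex.ofReal_zero, zero_pow hd, zero_mul, Complex.exp_zero] at h0
  exact (mul_eq_zero.1 h0.symm).resolve_left (pow_ne_zero _ (by norm_num))

end Brion

/-! ### Admissible parameters accumulate at zero -/

section Parameters

variable {d : ℕ}

/-- The pairing with `ξ` as a continuous linear map. -/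
noncomputable def pairingCLM (ξ : Fin d → ℂ) : (Fin d → ℝ) →L[ℝ] ℂ :=
  ∑ k, (ContinuousLinearMap.proj k).smulRight (ξ k)

theorem pairingCLM_apply (ξ : Fin d → ℂ) (x : Fin d → ℝ) : pairingCLM ξ x = pairing x ξ := by
  simp [pairingCLM, pairing]

/-- Along the curve (z, z², …, z^d) the pairing is a polynomial in `z` whose coefficient of z^(k+1)
is `u k`, so it is not identically zero. -/
theorem finite_setOf_pairing_shifted_pow_eq_zero {u : Fin d → ℝ} (hu : u ≠ 0) (m : Fin d → ℤ) :
    {z : ℝ | pairing u (shifted m fun k => (z : ℂ) ^ ((k : ℕ) + 1)) = 0}.Finite := by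
  classical
  set q : Polynomial ℂ := Polynomial.C (∑ k, (u k : ℂ) * m k) +
    ∑ k : Fin d, Polynomial.C (u k : ℂ) * Polynomial.X ^ ((k : ℕ) + 1) with hq
  have hq0 : q ≠ 0 := by
    obtain ⟨k, hk⟩ := Function.ne_iff.1 hu
    intro h
    have h1 := congr_arg (fun r => Polynomial.coeff r ((k : ℕ) + 1)) h
    simp only [hq, Polynomial.coeff_add, Polynomial.coeff_C_succ, Polynomial.finsetSum_coeff,
      Polynomial.coeff_C_mul_X_pow, zero_add, Polynomial.coeff_zero, add_left_inj,
      Fin.val_inj] at h1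
    rw [Finset.sum_ite_eq Finset.univ k, if_pos (Finset.mem_univ k)] at h1
    exact hk (by exact_mod_cast h1)
  refine ((q.roots.toFinset : Set ℂ).toFinite.preimage
    Complex.ofReal_injective.injOn).subset fun z hz => ?_
  rw [Set.mem_preimage, Finset.mem_coe, Multiset.mem_toFinset, Polynomial.mem_roots hq0,
    Polynomial.IsRoot.def]
  have h1 : pairing u (shifted m fun k => (z : ℂ) ^ ((k : ℕ) + 1)) = 0 := hz
  rw [← h1]
  simp [hq, pairing, shifted, mul_add, Finset.sum_add_distrib, Polynomial.eval_finsetSum]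

/-- The moment curve passes through 0 and meets the countably many bad hyperplanes in countably many
parameters, whose complement is dense. -/
theorem zero_mem_closure_admissible {P : Set (Fin d → ℝ)}
    (hfin : (P.extremePoints ℝ).Finite) {w : (Fin d → ℝ) → Fin d → Fin d → ℝ}
    (hw : IsSimpleWith P w) : (0 : Fin d → ℂ) ∈ closure (admissible P w) := by
  set γ : ℝ → Fin d → ℂ := fun z k => (z : ℂ) ^ ((k : ℕ) + 1) with hγ
  set B : Set ℝ := ⋃ v ∈ P.extremePoints ℝ, ⋃ j, ⋃ m : Fin d → ℤ,
    {z : ℝ | pairing (w v j) (shifted m (γ z)) = 0} with hB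
  have hBc : B.Countable := hfin.countable.biUnion fun v hv => Set.countable_iUnion fun j =>
    Set.countable_iUnion fun m =>
      (finite_setOf_pairing_shifted_pow_eq_zero ((hw v hv).1.ne_zero j) m).countable
  have hmaps : Set.MapsTo γ Bᶜ (admissible P w) := by
    intro z hz v hv j m h
    exact hz (Set.mem_biUnion hv (Set.mem_iUnion.2 ⟨j, Set.mem_iUnion.2 ⟨m, h⟩⟩))
  have hγ0 : γ 0 = 0 := by
    funext k
    simp [hγ]
  rw [← hγ0]
  exact map_mem_closure (by fun_prop) (hBc.dense_compl ℝ 0) hmaps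

end Parameters

/-! ### Vanishing of each summand at `t = 0` -/

section Transform

variable {d : ℕ}

theorem hasDampedSum_zero (p : ℝ) (s : Fin d → ℂ) {F : (Fin d → ℤ) → ℂ} (hF : ∀ m, F m = 0) :
    HasDampedSum p s F 0 := by
  simp [HasDampedSum, hF, summable_zero]

/-- The integral is the complex moment generating function of `X` at 2πit, analytic everywhere as
`X` is bounded on `P`. -/
theorem analyticOnNhd_integral_exp_mul {P : Set (Fin d → ℝ)} (hP : IsCompact P)
    {X : (Fin d → ℝ) → ℝ} (hX : Continuous X) :
    AnalyticOnNhd ℝ (fun t : ℝ => ∫ x in P, Complex.exp (2 * Real.pi * Complex.I * t * X x))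
      Set.univ := by
  have hfin : IsFiniteMeasure (volume.restrict P) := ⟨by simpa using hP.measure_lt_top⟩
  have huniv : ProbabilityTheory.integrableExpSet X (volume.restrict P) = Set.univ :=
    Set.eq_univ_of_forall fun t => ContinuousOn.integrableOn_compact hP (by fun_prop)
  intro t _
  have h1 : AnalyticAt ℂ (ProbabilityTheory.complexMGF X (volume.restrict P))
      (2 * Real.pi * Complex.I * t) :=
    ProbabilityTheory.analyticAt_complexMGF (by simp [huniv])
  have h2 : AnalyticAt ℝ (fun t : ℝ => 2 * Real.pi * Complex.I * (t : ℂ)) t :=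
    analyticAt_const.mul (Complex.ofRealCLM.analyticAt t)
  exact (h1.restrictScalars (𝕜 := ℝ)).comp_of_eq h2 rfl

theorem pairing_shifted_zero (x : Fin d → ℝ) (m : Fin d → ℤ) :
    pairing x (shifted m 0) = ((x ⬝ᵥ latticePoint m : ℝ) : ℂ) := by
  simp [pairing, shifted, latticePoint, dotProduct]

theorem isTransformContinuation_latticePoint {P : Set (Fin d → ℝ)} (hP : IsCompact P)
    (m : Fin d → ℤ) :
    IsTransformContinuation P (shifted m 0) fun t => (t : ℂ) ^ d *
      ∫ x in P, Complex.exp (2 * Real.pi * Complex.I * t * (x ⬝ᵥ latticePoint m : ℝ)) := by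
  refine ⟨?_, fun t ht => ?_⟩
  · have hX : Continuous fun x : Fin d → ℝ => x ⬝ᵥ latticePoint m := by
      unfold dotProduct
      fun_prop
    refine AnalyticOnNhd.mul (fun t _ => ?_) (analyticOnNhd_integral_exp_mul hP hX)
    exact (Complex.ofRealCLM.analyticAt t).pow d
  · have h1 := Measure.setIntegral_comp_smul_of_pos volume
      (fun x : Fin d → ℝ => Complex.exp (2 * Real.pi * Complex.I * pairing x (shifted m 0))) P ht
    rw [Module.finrank_fin_fun, eq_inv_smul_iff₀ (pow_ne_zero _ ht.ne')] at h1
    rw [indicatorHat, ← h1, Complex.real_smul, Complex.ofReal_pow]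
    refine congr_arg ((t : ℂ) ^ d * ·) (congr_arg (fun f : (Fin d → ℝ) → ℂ => ∫ x in P, f x) ?_)
    funext x
    rw [pairing_shifted_zero, smul_dotProduct, smul_eq_mul, Complex.ofReal_mul, mul_assoc _ (t : ℂ)]

theorem hasSolidAngleSum_zero (hd : d ≠ 0) (p : ℝ) {P : Set (Fin d → ℝ)} (hP : P.Nonempty)
    (s : Fin d → ℂ) : HasSolidAngleSum p P 0 s 0 := by
  have : Nonempty (Fin d) := Fin.pos_iff_nonempty.1 (Nat.pos_of_ne_zero hd)
  refine ⟨fun _ => 0, fun m => ?_, by simp [hasSum_zero]⟩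
  have h0 : volume ((0 : ℝ) • P) = 0 := by
    rw [Set.zero_smul_set hP]
    exact measure_singleton 0
  simp [IsSolidAngle, Measure.restrict_eq_zero.2 h0]

theorem vertexTransform_zero {n : ℕ} {a : Fin n → Fin d → ℝ} {b : Fin n → ℝ} (hd : d ≠ 0)
    {w : (Fin d → ℝ) → Fin d → Fin d → ℝ} (hP : Bornology.IsBounded (halfspaces a b))
    (hw : IsSimpleWith (halfspaces a b) w) {ξ : Fin d → ℂ}
    (hξ : ∀ v ∈ (halfspaces a b).extremePoints ℝ, ∀ j, pairing (w v j) ξ ≠ 0) :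
    vertexTransform (halfspaces a b) w 0 ξ = 0 := by
  have h := sum_det_div_prod_eq_zero hd hP hw (pairingCLM ξ) fun v hv j => by
    rw [pairingCLM_apply]
    exact hξ v hv j
  rw [vertexTransform, finsum_mem_eq_finite_toFinset_sum _ (finite_extremePoints_halfspaces a b)]
  simp only [pairingCLM_apply] at h
  -- At `t = 0` the exponentials are 1 and (-2πi)^d is a common denominator.
  simp only [Complex.ofReal_zero, mul_zero, zero_mul, Complex.exp_zero, div_mul_eq_mul_div,
    ← Finset.sum_div, h, zero_div]

end Transform

end SolidAngle

theorem mainTheorem5 (d : ℕ) (hd : Odd d) (p : ℝ) (hp : 1 ≤ p)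
    (P : Set (Fin d → ℝ)) (hP : SolidAngle.IsFullPolytope P) :
    SolidAngle.HasSolidAngleSum p P 0 0 0 ∧
    SolidAngle.HasContinuedSum p P 0 0 0 ∧
    ∀ w : (Fin d → ℝ) → Fin d → Fin d → ℝ, SolidAngle.IsSimpleWith P w →
      SolidAngle.HasVertexSumAtZero p P w 0 0 := by
  have hd0 : d ≠ 0 := hd.pos.ne'
  obtain ⟨⟨hbdd, n, a, b, hPab⟩, hspan⟩ := hP
  obtain rfl : P = SolidAngle.halfspaces a b := hPab
  have hcomp := Metric.isCompact_of_isClosed_isBounded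
    (SolidAngle.isClosed_halfspaces (a := a) (b := b)) hbdd
  have hne : (SolidAngle.halfspaces a b).Nonempty :=
    AffineSubspace.nonempty_of_affineSpan_eq_top ℝ _ _ hspan
  refine ⟨SolidAngle.hasSolidAngleSum_zero hd0 p hne 0, ⟨_, fun m =>
    SolidAngle.isTransformContinuation_latticePoint hcomp m,
    SolidAngle.hasDampedSum_zero p 0 fun m => ?_⟩, fun w hw => ⟨?_, fun _ => 0, fun s hs => ?_, ?_⟩⟩
  -- The factor `t ^ d` of the continuation is 0 at `t = 0`.
  · simp [hd0]
  · exact SolidAngle.zero_mem_closure_admissible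
      (SolidAngle.finite_extremePoints_halfspaces a b) hw
  · exact SolidAngle.hasDampedSum_zero p s fun m =>
      SolidAngle.vertexTransform_zero hd0 hbdd hw fun v hv j => hs v hv j m
  · exact tendsto_const_nhds
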